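/- Let $m\ge 0$ and $\delta\ge 1$ be integers and let $t_1<\dots<t_m$ be real numbers. For $n \ge 1$ write $p_n(s)=(s,s^2,\dots,s^n)\in\mathbb{R}^n$ for the moment curve; for $A\subseteq\{1,\dots,m\}$ put $|A|_n=\mathrm{conv}\{p_n(t_i): i\in A\}$, and let $C(m,n)=\mathrm{conv}\{p_n(t_1),\dots,p_n(t_m)\}$ be the cyclic polytope. A triangulation $\mathcal{T}$ of $C(m,\delta)$ is a set of $(\delta+1)$-element subsets of $\{1,\dots,m\}$ whose simplices $|A|_\delta$, $A\in\mathcal{T}$, cover $C(m,\delta)$ and satisfy $|A|_\delta\cap|B|_\delta=|A\cap B|_\delta$ for all $A,B\in\mathcal{T}$. For $A$ with at most $\delta+1$ elements let $s_{|A|}\colon|A|_\delta\to|A|_{\delta+1}$ send $x$ to the unique point of $|A|_{\delta+1}$ whose first $\delta$ coordinates form $x$; let $s_{\mathcal{T}}\colon C(m,\delta)\to C(m,\delta+1)$ be the map that agrees with $s_{|A|}$ on $|A|_\delta$ for each $A\in\mathcal{T}$. The second higher Stasheff--Tamari order is defined by \[\mathcal{T}\leqslant_2\mathcal{T}' \iff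 s_{\mathcal{T}}(x)_{\delta+1}\le s_{\mathcal{T}'}(x)_{\delta+1}\ \text{ for all } x\in C(m,\delta).\] For $0\le k\le\delta$, the $k$-supermersion set $\mathrm{sup}_k\mathcal{T}$ is the set of $k$-simplices $|A|_\delta$, where $A$ is a $(k+1)$-element subset of $\{1,\dots,m\}$ (with which the simplex is identified), such that $s_{|A|}(x)_{\delta+1}\ge s_{\mathcal{T}}(x)_{\delta+1}$ for all $x\in|A|_\delta$. Theorem. For all triangulations $\mathcal{T},\mathcal{T}'$ of $C(m,\delta)$, \[\mathcal{T}\leqslant_2\mathcal{T}' \iff \mathrm{sup}_{\lfloor\delta/2\rfloor}\mathcal{T}\supseteq\mathrm{sup}_{\lfloor\delta/2\rfloor}\mathcal{T}'.\] -/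

import Mathlib

noncomputable section

namespace CyclicPolytope

/-- The point `(s, s², …, s^δ)` of the moment curve in `ℝ^δ`. -/
def momentCurve (δ : ℕ) (s : ℝ) : Fin δ → ℝ := fun j => s ^ ((j : ℕ) + 1)

/-- For a tuple (finite set of vertex labels) `A`, the geometric simplex `|A|_δ`: the convex hull
in `ℝ^δ` of the points with parameters `t i`, `i ∈ A`, on the moment curve. -/
def simplex {m : ℕ} (t : Fin m → ℝ) (δ : ℕ) (A : Finset (Fin m)) : Set (Fin δ → ℝ) :=
  convexHull ℝ ((fun i => momentCurve δ (t i)) '' (A : Set (Fin m)))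

/-- The cyclic polytope `C(m,δ)` with parameters `t 0 < ⋯ < t (m-1)`. -/
def cyclicPolytope {m : ℕ} (t : Fin m → ℝ) (δ : ℕ) : Set (Fin δ → ℝ) :=
  convexHull ℝ (Set.range fun i => momentCurve δ (t i))

/-- A triangulation of `C(m,δ)`, given by the vertex tuples of its `δ`-simplices: these simplices
cover the polytope, and any two of them meet in their common face (possibly empty). -/
structure Triangulation {m : ℕ} (t : Fin m → ℝ) (δ : ℕ) where
  simplices : Finset (Finset (Fin m))
  card_eq : ∀ A ∈ simplices, A.card = δ + 1
  cover : ⋃ A ∈ simplices, simplex t δ A = cyclicPolytope t δ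
  inter : ∀ A ∈ simplices, ∀ B ∈ simplices,
    simplex t δ A ∩ simplex t δ B = simplex t δ (A ∩ B)

/-- The projection `ℝ^(δ+1) → ℝ^δ` forgetting the last coordinate. -/
def proj (δ : ℕ) : (Fin (δ + 1) → ℝ) →ₗ[ℝ] (Fin δ → ℝ) :=
  LinearMap.funLeft ℝ ℝ Fin.castSucc

open Classical in
/-- The section `s_{|A|} : |A|_δ → C(m,δ+1)`: the point `x` of `|A|_δ` goes to the point of
`|A|_{δ+1}` above it, which exists by `exists_mem_simplex_succ` and is unique by
`simplex_succ_unique` (the value is `0` outside `|A|_δ`). -/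
def simplexSection {m : ℕ} (t : Fin m → ℝ) (δ : ℕ) (A : Finset (Fin m)) (x : Fin δ → ℝ) :
    Fin (δ + 1) → ℝ :=
  if h : ∃ y ∈ simplex t (δ + 1) A, proj δ y = x then h.choose else 0

open Classical in
/-- The piecewise-linear section `s_T : C(m,δ) → C(m,δ+1)` of a triangulation `T`: on each
`δ`-simplex `|A|_δ` of `T` it agrees with `s_{|A|}`, see `sec_eq_simplexSection`
(the value is `0` outside the polytope). -/
def Triangulation.sec {m : ℕ} {t : Fin m → ℝ} {δ : ℕ} (T : Triangulation t δ) (x : Fin δ → ℝ) :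
    Fin (δ + 1) → ℝ :=
  if h : ∃ A ∈ T.simplices, x ∈ simplex t δ A then simplexSection t δ h.choose x else 0

/-- The second higher Stasheff–Tamari order `T ≤₂ T'`: the section of `T` lies weakly below the
section of `T'` in the last coordinate, over every point of the polytope. -/
def Triangulation.SecondLE {m : ℕ} {t : Fin m → ℝ} {δ : ℕ} (T T' : Triangulation t δ) : Prop :=
  ∀ x ∈ cyclicPolytope t δ, T.sec x (Fin.last δ) ≤ T'.sec x (Fin.last δ)

/-- `T` supermerges the simplex `|A|_δ`: over every point of it, the section of the simplex lies
weakly above the section of `T` in the last coordinate. -/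
def Triangulation.Supermerges {m : ℕ} {t : Fin m → ℝ} {δ : ℕ} (T : Triangulation t δ)
    (A : Finset (Fin m)) : Prop :=
  ∀ x ∈ simplex t δ A, T.sec x (Fin.last δ) ≤ simplexSection t δ A x (Fin.last δ)

/-- The `k`-supermersion set of `T`: the `k`-simplices (as vertex tuples) supermerged by `T`. -/
def Triangulation.supermersionSet {m : ℕ} {t : Fin m → ℝ} {δ : ℕ} (T : Triangulation t δ)
    (k : ℕ) : Set (Finset (Fin m)) :=
  {A | A.card = k + 1 ∧ T.Supermerges A}

/-! The sections are well defined. -/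

theorem proj_momentCurve (δ : ℕ) (s : ℝ) : proj δ (momentCurve (δ + 1) s) = momentCurve δ s := by
  ext j
  simp [proj, momentCurve, LinearMap.funLeft]

theorem proj_image_simplex {m : ℕ} (t : Fin m → ℝ) (δ : ℕ) (A : Finset (Fin m)) :
    proj δ '' simplex t (δ + 1) A = simplex t δ A := by
  simp only [simplex, LinearMap.image_convexHull, Set.image_image, proj_momentCurve]

theorem exists_mem_simplex_succ {m : ℕ} {t : Fin m → ℝ} {δ : ℕ} {A : Finset (Fin m)}
    {x : Fin δ → ℝ} (hx : x ∈ simplex t δ A) : ∃ y ∈ simplex t (δ + 1) A, proj δ y = x := by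
  rw [← proj_image_simplex] at hx
  exact hx

theorem simplex_mono {m : ℕ} (t : Fin m → ℝ) (δ : ℕ) {A B : Finset (Fin m)} (h : A ⊆ B) :
    simplex t δ A ⊆ simplex t δ B :=
  convexHull_mono (Set.image_mono (by exact_mod_cast h))

/-- Over a tuple of at most `δ + 1` vertices, points are determined by their projection. -/
theorem simplex_succ_unique {m : ℕ} {t : Fin m → ℝ} (ht : StrictMono t) {δ : ℕ}
    {A : Finset (Fin m)} (hA : A.card ≤ δ + 1) {y z : Fin (δ + 1) → ℝ}
    (hy : y ∈ simplex t (δ + 1) A) (hz : z ∈ simplex t (δ + 1) A) (h : proj δ y = proj δ z) :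
    y = z := by
  let q : Polynomial ℝ := Lagrange.interpolate A t fun i => t i ^ (δ + 1)
  have hinj : Set.InjOn t A := ht.injective.injOn
  have hq : q.natDegree < δ + 1 := by
    rcases eq_or_ne q 0 with h0 | h0
    · simp [h0]
    · rw [Polynomial.natDegree_lt_iff_degree_lt h0]
      exact (Lagrange.degree_interpolate_lt _ hinj).trans_le (by exact_mod_cast hA)
  let f : (Fin (δ + 1) → ℝ) →ₗ[ℝ] ℝ :=
    LinearMap.proj (Fin.last δ) -
      (∑ j : Fin δ, q.coeff (j + 1) • LinearMap.proj j) ∘ₗ proj δ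
  have key : simplex t (δ + 1) A ⊆ {w | f w = q.coeff 0} := by
    refine convexHull_min ?_ (convex_hyperplane f.isLinear _)
    rintro _ ⟨i, hi, rfl⟩
    have he : q.eval (t i) = t i ^ (δ + 1) := Lagrange.eval_interpolate_at_node _ hinj hi
    rw [Polynomial.eval_eq_sum_range' hq, Finset.sum_range_succ', Finset.sum_range] at he
    have : f (momentCurve (δ + 1) (t i)) =
        t i ^ (δ + 1) - ∑ j : Fin δ, q.coeff (j + 1) * t i ^ ((j : ℕ) + 1) := by
      simp [f, proj_momentCurve, momentCurve]
    simp only [Set.mem_ofPred_eq, this]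
    simp at he
    linarith
  have hy' : f y = _ := key hy
  have hz' : f z = _ := key hz
  have hl : y (Fin.last δ) = z (Fin.last δ) := by
    simp only [f, LinearMap.sub_apply, LinearMap.comp_apply, h, LinearMap.proj_apply] at hy' hz'
    linarith
  ext j
  refine Fin.lastCases hl (fun j => ?_) j
  exact congrFun h j

theorem simplexSection_mem {m : ℕ} {t : Fin m → ℝ} {δ : ℕ} {A : Finset (Fin m)}
    {x : Fin δ → ℝ} (hx : x ∈ simplex t δ A) :
    simplexSection t δ A x ∈ simplex t (δ + 1) A ∧ proj δ (simplexSection t δ A x) = x := by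
  have h := exists_mem_simplex_succ hx
  rw [simplexSection, dif_pos h]
  exact h.choose_spec

theorem sec_eq_simplexSection {m : ℕ} {t : Fin m → ℝ} (ht : StrictMono t) {δ : ℕ}
    (T : Triangulation t δ) {A : Finset (Fin m)} (hA : A ∈ T.simplices) {x : Fin δ → ℝ}
    (hx : x ∈ simplex t δ A) : T.sec x = simplexSection t δ A x := by
  have h : ∃ A ∈ T.simplices, x ∈ simplex t δ A := ⟨A, hA, hx⟩
  rw [Triangulation.sec, dif_pos h]
  obtain ⟨hB, hxB⟩ := h.choose_spec
  generalize h.choose = B at hB hxB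
  have hAB : x ∈ simplex t δ (A ∩ B) := by
    rw [← T.inter A hA B hB]
    exact ⟨hx, hxB⟩
  obtain ⟨z, hz, hzx⟩ := exists_mem_simplex_succ hAB
  obtain ⟨h1, h2⟩ := simplexSection_mem hx
  obtain ⟨h3, h4⟩ := simplexSection_mem hxB
  rw [simplex_succ_unique ht (T.card_eq B hB).le h3
      (simplex_mono t _ Finset.inter_subset_right hz) (h4.trans hzx.symm),
    simplex_succ_unique ht (T.card_eq A hA).le h1
      (simplex_mono t _ Finset.inter_subset_left hz) (h2.trans hzx.symm)]

end CyclicPolytope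

end

/-! If `T ≤₂ T'`, whatever lies above the section of `T'` lies above that of `T`.

Conversely, suppose that over some point the section of `T`, in a simplex `A`, is strictly higher
than that of `T'`, in a simplex `B`. The difference of the barycentric weights is an affine
dependency in `ℝ^δ` with positive moment of order `δ + 1`. Conformal elimination shrinks its support
to at most `δ + 2` points, with positive entries still in `A` and negative ones in `B`. On the
moment curve the surviving signs alternate, so at most `δ / 2 + 1` are negative
(`card_neg_le_of_moment_pos`). Thus some `δ / 2`-face of `B` has a point strictly below a point of
`A` (`exists_circuit`): `T'` supermerges that face and `T` does not. -/

namespace CyclicPolytope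

open Finset

/-! ### Conformal elimination -/

/-- One step of conformal elimination: a vector whose support is larger than the number of linear
constraints can be moved inside its closed orthant, without changing the values of the constraints,
to a vector of smaller support. -/
theorem exists_conformal_card_support_lt {ι : Type*} [Fintype ι] {k : ℕ}
    (M : (ι → ℝ) →ₗ[ℝ] (Fin k → ℝ)) (v : ι → ℝ) (hk : k < #{i | v i ≠ 0}) :
    ∃ v' : ι → ℝ, M v' = M v ∧ (∀ i, 0 < v' i → 0 < v i) ∧ (∀ i, v' i < 0 → v i < 0) ∧
      #{i | v' i ≠ 0} < #{i | v i ≠ 0} := by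
  classical
  set S : Finset ι := {i | v i ≠ 0} with hS
  let E : (S → ℝ) →ₗ[ℝ] (ι → ℝ) := Function.ExtendByZero.linearMap ℝ Subtype.val
  have hker : LinearMap.ker (M ∘ₗ E) ≠ ⊥ :=
    LinearMap.ker_ne_bot_of_finrank_lt (by simpa using hk)
  obtain ⟨u, hu, hu0⟩ := Submodule.exists_mem_ne_zero_of_ne_bot hker
  let w : ι → ℝ := E u
  have hMw : M w = 0 := hu
  have hwS : ∀ i : S, w i = u i := fun i => Subtype.val_injective.extend_apply u 0 i
  have hw0 : ∀ i, v i = 0 → w i = 0 := fun i hi =>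
    Function.extend_apply' _ _ _ (by rintro ⟨⟨j, hj⟩, rfl⟩; simp [hS, hi] at hj)
  obtain ⟨j, hj⟩ := Function.ne_iff.1 hu0
  have hne : (univ.filter fun i => w i ≠ 0).Nonempty := ⟨j, by simpa [hwS] using hj⟩
  -- Minimality of the ratio gives `|c * w i| ≤ |v i|` for all `i`, so no entry of `v - c • w`
  -- crosses zero, while the entry at `i₀` vanishes.
  obtain ⟨i₀, hi₀, hmin⟩ := exists_min_image _ (fun i => |v i| / |w i|) hne
  have hwi₀ : w i₀ ≠ 0 := by simpa using hi₀
  set c := v i₀ / w i₀ with hc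
  have hle : ∀ i, |c * w i| ≤ |v i| := by
    intro i
    by_cases hi : w i = 0
    · simp [hi]
    · have := hmin i (by simpa using hi)
      rw [le_div_iff₀ (abs_pos.2 hi)] at this
      rwa [abs_mul, hc, abs_div]
  refine ⟨v - c • w, by simp [hMw], fun i hi => ?_, fun i hi => ?_, card_lt_card ?_⟩
  · have h := hle i
    simp only [Pi.sub_apply, Pi.smul_apply, smul_eq_mul] at hi
    by_contra! h'
    rw [abs_of_nonpos h'] at h
    linarith [neg_abs_le (c * w i)]
  · have h := hle i
    simp only [Pi.sub_apply, Pi.smul_apply, smul_eq_mul] at hi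
    by_contra! h'
    rw [abs_of_nonneg h'] at h
    linarith [le_abs_self (c * w i)]
  · refine (ssubset_iff_of_subset fun i hi => ?_).2 ⟨i₀, ?_, ?_⟩
    · simp only [mem_filter, mem_univ, true_and] at hi
      simp only [hS, mem_filter, mem_univ, true_and]
      intro h
      exact hi (by simp [h, hw0 i h])
    · simpa [hS] using fun h => hwi₀ (hw0 i₀ h)
    · simp [hc, hwi₀]

/-- A vector can be moved inside its closed orthant, without changing the values of `k` linear
functionals, to a vector with at most `k` nonzero entries. -/
theorem exists_conformal_card_support_le {ι : Type*} [Fintype ι] {k : ℕ}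
    (M : (ι → ℝ) →ₗ[ℝ] (Fin k → ℝ)) (v : ι → ℝ) :
    ∃ v' : ι → ℝ, M v' = M v ∧ (∀ i, 0 < v' i → 0 < v i) ∧ (∀ i, v' i < 0 → v i < 0) ∧
      #{i | v' i ≠ 0} ≤ k := by
  induction h : #{i | v i ≠ 0} using Nat.strong_induction_on generalizing v with
  | _ n ih =>
    by_cases hk : n ≤ k
    · exact ⟨v, rfl, fun _ => id, fun _ => id, h ▸ hk⟩
    · obtain ⟨u, hMu, hpos, hneg, hlt⟩ := exists_conformal_card_support_lt M v (by omega)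
      obtain ⟨v', hM', hpos', hneg', hle⟩ := ih _ (h ▸ hlt) u rfl
      exact ⟨v', hM'.trans hMu, fun i hi => hpos i (hpos' i hi), fun i hi => hneg i (hneg' i hi),
        hle⟩

/-! ### Sign patterns of dependencies on the moment curve -/

/-- Pairing a vector with vanishing moments of order less than `n` against a monic polynomial of
degree `n` gives its moment of order `n`. -/
theorem sum_mul_eval_monic {ι : Type*} [Fintype ι] (t v : ι → ℝ) {n : ℕ}
    (hv : ∀ k < n, ∑ i, v i * t i ^ k = 0) {q : Polynomial ℝ} (hq : q.Monic)
    (hdeg : q.natDegree = n) : ∑ i, v i * q.eval (t i) = ∑ i, v i * t i ^ n := by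
  have : ∀ i, v i * q.eval (t i) =
      ∑ k ∈ range n, q.coeff k * (v i * t i ^ k) + v i * t i ^ n := by
    intro i
    have hlead : q.coeff n = 1 := hdeg ▸ hq
    rw [Polynomial.eval_eq_sum_range, hdeg, sum_range_succ, hlead, mul_add, mul_sum, one_mul]
    congr 1
    exact sum_congr rfl fun k _ => by ring
  rw [sum_congr rfl fun i _ => this i, sum_add_distrib, sum_comm, add_eq_right]
  refine sum_eq_zero fun k hk => ?_
  rw [← mul_sum, hv k (mem_range.1 hk), mul_zero]

/-- Pairing with `∏ (X - t j)` over `S.erase i` kills every term except that of `i`. This ties the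
sign of `v i` to the number of `j ∈ S` with `t i < t j`. -/
theorem mul_prod_sub_eq_moment {ι : Type*} [Fintype ι] [DecidableEq ι] (t v : ι → ℝ) {n : ℕ}
    (hv : ∀ k < n, ∑ i, v i * t i ^ k = 0) {S : Finset ι} (hS : ∀ i ∉ S, v i = 0)
    {i : ι} (hcard : #(S.erase i) = n) :
    v i * ∏ j ∈ S.erase i, (t i - t j) = ∑ i, v i * t i ^ n := by
  rw [← sum_mul_eval_monic t v hv (Polynomial.monic_prod_X_sub_C t (S.erase i))
    (by simp [hcard]), sum_eq_single i]
  · simp [Polynomial.eval_prod]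
  · intro k _ hk
    by_cases hkS : k ∈ S
    · rw [Polynomial.eval_prod, prod_eq_zero (mem_erase.2 ⟨hk, hkS⟩) (by simp), mul_zero]
    · rw [hS k hkS, zero_mul]
  · simp

/-- An affine dependency of points on the moment curve of minimal support alternates in sign. Hence,
when its leading moment is positive, at most half of its entries are negative. -/
theorem card_neg_le_of_moment_pos {m n : ℕ} {t : Fin m → ℝ} (ht : StrictMono t) {v : Fin m → ℝ}
    (hv : ∀ k < n, ∑ i, v i * t i ^ k = 0) (hpos : 0 < ∑ i, v i * t i ^ n)
    (hcard : #{i | v i ≠ 0} ≤ n + 1) : #{i | v i < 0} ≤ (n + 1) / 2 := by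
  classical
  set S : Finset (Fin m) := {i | v i ≠ 0} with hS
  by_cases hfew : #S < n + 1
  · have hSne : S.Nonempty := by
      rw [nonempty_iff_ne_empty]
      intro h0
      have : ∀ i, v i = 0 := fun i => by
        by_contra h
        exact notMem_empty i (h0 ▸ (by simpa [hS] using h))
      simp [this] at hpos
    refine absurd hpos (not_lt.2 (le_of_eq ?_))
    have hlt : #S ≤ n := by omega
    obtain ⟨i, hi⟩ := hSne
    -- A monic polynomial of degree `n` that vanishes on the support annihilates `v`.
    let q : Polynomial ℝ := Polynomial.X ^ (n - #S) * ∏ j ∈ S, (Polynomial.X - Polynomial.C (t j))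
    have hqm : q.Monic := (Polynomial.monic_X_pow _).mul (Polynomial.monic_prod_X_sub_C t S)
    have hqd : q.natDegree = n := by
      rw [Polynomial.Monic.natDegree_mul (Polynomial.monic_X_pow _)
        (Polynomial.monic_prod_X_sub_C t S)]
      simp only [Polynomial.natDegree_X_pow, Polynomial.natDegree_finsetProd_X_sub_C_eq_card]
      omega
    rw [← sum_mul_eval_monic t v hv hqm hqd]
    refine sum_eq_zero fun k _ => ?_
    by_cases hk : v k = 0
    · simp [hk]
    · have hkS : k ∈ S := by simpa [hS] using hk
      simp only [q, Polynomial.eval_mul, Polynomial.eval_prod]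
      rw [prod_eq_zero hkS (by simp), mul_zero, mul_zero]
  · have hScard : #S = n + 1 := by omega
    -- On the support the sign of `v i` is `(-1) ^ r i`, where `r i` counts the support points to
    -- the right of `i`; negative entries have odd rank.
    let r : Fin m → ℕ := fun i => #{j ∈ S | i < j}
    have hr : ∀ i ∈ S, v i < 0 → Odd (r i) := by
      intro i hi hvi
      by_contra hodd
      rw [Nat.not_odd_iff_even] at hodd
      have hmul := mul_prod_sub_eq_moment t v hv (S := S)
        (fun j hj => by simpa [hS] using hj) (i := i) (by rw [card_erase_of_mem hi]; omega)
      have hprod : 0 < ∏ j ∈ S.erase i, (t i - t j) := by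
        rw [← prod_filter_mul_prod_filter_not (S.erase i) (fun j => i < j)]
        refine mul_pos ?_ (prod_pos fun j hj => ?_)
        · have hE : (S.erase i).filter (fun j => i < j) = S.filter fun j => i < j := by
            ext j
            simp only [mem_filter, mem_erase]
            exact ⟨fun h => ⟨h.1.2, h.2⟩, fun h => ⟨⟨h.2.ne', h.1⟩, h.2⟩⟩
          have hflip : ∏ j ∈ S with i < j, (t i - t j) = ∏ j ∈ S with i < j, (t j - t i) := by
            have heven : (-1 : ℝ) ^ #{j ∈ S | i < j} = 1 := Even.neg_one_pow hodd
            rw [← one_mul (∏ j ∈ S with i < j, (t j - t i)), ← heven, ← prod_const,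
              ← prod_mul_distrib]
            exact prod_congr rfl fun _ _ => by ring
          rw [hE, hflip]
          exact prod_pos fun j hj => sub_pos.2 (ht (mem_filter.1 hj).2)
        · simp only [mem_filter, mem_erase, not_lt] at hj
          exact sub_pos.2 (ht (lt_of_le_of_ne hj.2 hj.1.1))
      exact absurd (hmul ▸ hpos) (not_lt.2 (mul_neg_of_neg_of_pos hvi hprod).le)
    have hanti : ∀ i ∈ S, ∀ j ∈ S, i < j → r j < r i := fun i _ j hj hij =>
      card_lt_card ((ssubset_iff_of_subset fun k hk => by
        simp only [mem_filter] at hk ⊢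
        exact ⟨hk.1, hij.trans hk.2⟩).2 ⟨j, by simp [hj, hij], by simp⟩)
    have hlt : ∀ i ∈ S, r i < n + 1 := fun i hi =>
      hScard ▸ card_lt_card ((ssubset_iff_of_subset (filter_subset _ _)).2 ⟨i, hi, by simp⟩)
    have hnegS : ∀ i, v i < 0 → i ∈ S := fun i hi => by simpa [hS] using hi.ne
    calc #{i | v i < 0} ≤ #(range ((n + 1) / 2)) := by
          -- Ranks are distinct and at most `n`, and halving is injective on odd numbers.
          refine card_le_card_of_injOn (fun i => r i / 2) (fun i hi => ?_) fun i hi j hj hij => ?_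
          · have hi' : v i < 0 := by simpa using hi
            obtain ⟨a, ha⟩ := hr i (hnegS i hi') hi'
            have := hlt i (hnegS i hi')
            simp only [coe_range, Set.mem_Iio]
            omega
          · have hi' : v i < 0 := by simpa using hi
            have hj' : v j < 0 := by simpa using hj
            obtain ⟨a, ha⟩ := hr i (hnegS i hi') hi'
            obtain ⟨b, hb⟩ := hr j (hnegS j hj') hj'
            have hij' : r i / 2 = r j / 2 := hij
            rcases lt_trichotomy i j with h | h | h
            · have := hanti i (hnegS i hi') j (hnegS j hj') h
              omega
            · exact h
            · have := hanti j (hnegS j hj') i (hnegS i hi') h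
              omega
      _ = _ := card_range _

/-! ### Sections in barycentric coordinates -/

theorem sum_smul_mem_simplex {m : ℕ} (t : Fin m → ℝ) (δ : ℕ) {A : Finset (Fin m)}
    {w : Fin m → ℝ} (h0 : ∀ i, 0 ≤ w i) (hA : ∀ i ∉ A, w i = 0) (h1 : ∑ i, w i = 1) :
    ∑ i, w i • momentCurve δ (t i) ∈ simplex t δ A := by
  rw [← sum_subset (subset_univ A) fun i _ hi => hA i hi] at h1
  rw [← sum_subset (subset_univ A) fun i _ hi => by rw [hA i hi, zero_smul]]
  exact (convex_convexHull ℝ _).sum_mem (fun i _ => h0 i) h1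
    fun i hi => subset_convexHull ℝ _ ⟨i, hi, rfl⟩

/-- Weights live on all of `Fin m`, so that those of two different simplices can be subtracted. The
image of the convex set of weights is convex and contains the vertices. -/
theorem exists_weights_of_mem_simplex {m : ℕ} {t : Fin m → ℝ} {δ : ℕ} {A : Finset (Fin m)}
    {x : Fin δ → ℝ} (hx : x ∈ simplex t δ A) :
    ∃ w : Fin m → ℝ, (∀ i, 0 ≤ w i) ∧ (∀ i ∉ A, w i = 0) ∧ ∑ i, w i = 1 ∧
      ∑ i, w i • momentCurve δ (t i) = x := by
  classical
  let W : Set (Fin m → ℝ) := {w | (∀ i, 0 ≤ w i) ∧ (∀ i ∉ A, w i = 0) ∧ ∑ i, w i = 1}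
  have hW : Convex ℝ W := by
    rintro u ⟨hu0, huA, hu1⟩ w ⟨hw0, hwA, hw1⟩ a b ha hb hab
    refine ⟨fun i => ?_, fun i hi => ?_, ?_⟩
    · exact add_nonneg (mul_nonneg ha (hu0 i)) (mul_nonneg hb (hw0 i))
    · simp [huA i hi, hwA i hi]
    · simp [sum_add_distrib, ← mul_sum, hu1, hw1, hab]
  let f : (Fin m → ℝ) →ₗ[ℝ] (Fin δ → ℝ) :=
    ∑ i, (LinearMap.proj i : (Fin m → ℝ) →ₗ[ℝ] ℝ).smulRight (momentCurve δ (t i))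
  have hf : ∀ w, f w = ∑ i, w i • momentCurve δ (t i) := fun w => by simp [f]
  have hsub : simplex t δ A ⊆ f '' W := by
    refine convexHull_min ?_ (hW.linear_image f)
    rintro _ ⟨i, hi, rfl⟩
    refine ⟨Pi.single i 1, ⟨fun j => ?_, fun j hj => ?_, by simp⟩, ?_⟩
    · by_cases h : j = i
      · subst h; simp
      · simp [h]
    · exact Pi.single_eq_of_ne (by rintro rfl; exact hj hi) _
    · rw [hf, sum_eq_single i (fun j _ hj => by simp [hj]) (by simp)]
      simp
  obtain ⟨w, ⟨h0, hA, h1⟩, rfl⟩ := hsub hx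
  exact ⟨w, h0, hA, h1, (hf w).symm⟩

/-- Lifting keeps the weights: the same combination one dimension up projects to the given point,
and at most `δ + 1` vertices leave only one such point. -/
theorem simplexSection_sum_smul {m : ℕ} {t : Fin m → ℝ} (ht : StrictMono t) {δ : ℕ}
    {A : Finset (Fin m)} (hcard : #A ≤ δ + 1) {w : Fin m → ℝ} (h0 : ∀ i, 0 ≤ w i)
    (hA : ∀ i ∉ A, w i = 0) (h1 : ∑ i, w i = 1) :
    simplexSection t δ A (∑ i, w i • momentCurve δ (t i)) =
      ∑ i, w i • momentCurve (δ + 1) (t i) := by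
  obtain ⟨hmem, hproj⟩ := simplexSection_mem (sum_smul_mem_simplex t δ h0 hA h1)
  refine simplex_succ_unique ht hcard hmem (sum_smul_mem_simplex t (δ + 1) h0 hA h1) ?_
  rw [hproj, map_sum]
  simp [proj_momentCurve]

theorem Triangulation.sec_sum_smul {m : ℕ} {t : Fin m → ℝ} (ht : StrictMono t) {δ : ℕ}
    (T : Triangulation t δ) {A : Finset (Fin m)} (hAT : A ∈ T.simplices) {w : Fin m → ℝ}
    (h0 : ∀ i, 0 ≤ w i) (hA : ∀ i ∉ A, w i = 0) (h1 : ∑ i, w i = 1) :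
    T.sec (∑ i, w i • momentCurve δ (t i)) = ∑ i, w i • momentCurve (δ + 1) (t i) := by
  rw [sec_eq_simplexSection ht T hAT (sum_smul_mem_simplex t δ h0 hA h1),
    simplexSection_sum_smul ht (T.card_eq A hAT).le h0 hA h1]

theorem sum_smul_momentCurve_last {m : ℕ} (t w : Fin m → ℝ) (δ : ℕ) :
    (∑ i, w i • momentCurve (δ + 1) (t i)) (Fin.last δ) = ∑ i, w i * t i ^ (δ + 1) := by
  simp [momentCurve]

/-- Every face of a simplex of a triangulation is supermerged by it. -/
theorem Triangulation.supermerges_of_subset {m : ℕ} {t : Fin m → ℝ} (ht : StrictMono t) {δ : ℕ}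
    (T : Triangulation t δ) {A F : Finset (Fin m)} (hA : A ∈ T.simplices) (hF : F ⊆ A) :
    T.Supermerges F := by
  intro x hx
  obtain ⟨w, h0, hw, h1, rfl⟩ := exists_weights_of_mem_simplex hx
  have hcard : #F ≤ δ + 1 := (card_le_card hF).trans (T.card_eq A hA).le
  rw [T.sec_sum_smul ht hA h0 (fun i hi => hw i fun h => hi (hF h)) h1,
    simplexSection_sum_smul ht hcard h0 hw h1]

theorem Triangulation.SecondLE.supermersionSet_subset {m : ℕ} {t : Fin m → ℝ} {δ : ℕ}
    {T T' : Triangulation t δ} (h : T.SecondLE T') (k : ℕ) :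
    T'.supermersionSet k ⊆ T.supermersionSet k := fun _ hA =>
  ⟨hA.1, fun x hx => (h x (convexHull_mono (Set.image_subset_range _ _) hx)).trans (hA.2 x hx)⟩

/-! ### Circuits and the hard direction -/

/-- If two simplices have points over `x` at different heights, there is a circuit of the cyclic
polytope whose upper part is a face of the higher simplex and whose lower part, which has at most
`⌊δ / 2⌋ + 1` vertices, is a face of the lower one. It is given by two convex combinations of the
same point of `ℝ^δ`. -/
theorem exists_circuit {m δ : ℕ} {t : Fin m → ℝ} (ht : StrictMono t) {a b : Fin m → ℝ}
    (ha0 : ∀ i, 0 ≤ a i) (hb0 : ∀ i, 0 ≤ b i)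
    (hab : ∀ k < δ + 1, ∑ i, a i * t i ^ k = ∑ i, b i * t i ^ k)
    (hlt : ∑ i, b i * t i ^ (δ + 1) < ∑ i, a i * t i ^ (δ + 1)) :
    ∃ a' b' : Fin m → ℝ, (∀ i, 0 ≤ a' i) ∧ (∀ i, 0 ≤ b' i) ∧ (∀ i, a i = 0 → a' i = 0) ∧
      (∀ i, b i = 0 → b' i = 0) ∧ ∑ i, a' i = 1 ∧ ∑ i, b' i = 1 ∧
      (∀ k < δ + 1, ∑ i, a' i * t i ^ k = ∑ i, b' i * t i ^ k) ∧
      ∑ i, b' i * t i ^ (δ + 1) < ∑ i, a' i * t i ^ (δ + 1) ∧ #{i | b' i ≠ 0} ≤ δ / 2 + 1 := by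
  -- The `δ + 2` constraints are the moments of orders `0` to `δ + 1`: all but the last preserve the
  -- affine dependency, the last preserves the height gap.
  let M : (Fin m → ℝ) →ₗ[ℝ] (Fin (δ + 2) → ℝ) :=
    LinearMap.pi fun k => ∑ i, (t i ^ (k : ℕ)) • LinearMap.proj i
  have hM : ∀ v (k : ℕ) (hk : k < δ + 2), M v ⟨k, hk⟩ = ∑ i, v i * t i ^ k := fun v k hk => by
    simp [M, mul_comm]
  obtain ⟨v, hMv, hpos, hneg, hcard⟩ := exists_conformal_card_support_le M (a - b)
  have hmom : ∀ k < δ + 2,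
      ∑ i, v i * t i ^ k = ∑ i, a i * t i ^ k - ∑ i, b i * t i ^ k := fun k hk => by
    rw [← hM v k hk, hMv, hM, ← sum_sub_distrib]
    exact sum_congr rfl fun i _ => by simp [sub_mul]
  have hv0 : ∀ k < δ + 1, ∑ i, v i * t i ^ k = 0 := fun k hk => by
    rw [hmom k (by omega), hab k hk, sub_self]
  have hvpos : 0 < ∑ i, v i * t i ^ (δ + 1) := by
    rw [hmom _ (by omega)]
    exact sub_pos.2 hlt
  have hnegcard := card_neg_le_of_moment_pos ht hv0 hvpos hcard
  have hpm : ∀ k, ∑ i, (v i)⁺ * t i ^ k - ∑ i, (v i)⁻ * t i ^ k = ∑ i, v i * t i ^ k := fun k => by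
    rw [← sum_sub_distrib]
    exact sum_congr rfl fun i _ => by rw [← sub_mul, posPart_sub_negPart]
  -- The zeroth moment vanishes, so both parts of `v` have the same mass `s`; dividing by it yields
  -- convex combinations.
  set s := ∑ i, (v i)⁺
  have hs' : ∑ i, (v i)⁻ = s := by
    have h := hpm 0
    rw [hv0 0 (by omega)] at h
    simp only [pow_zero, mul_one] at h
    linarith
  have hspos : 0 < s := by
    refine lt_of_le_of_ne (sum_nonneg fun i _ => posPart_nonneg _) fun h => ?_
    have hp := (sum_eq_zero_iff_of_nonneg fun i _ => posPart_nonneg (v i)).1 h.symm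
    have hn := (sum_eq_zero_iff_of_nonneg fun i _ => negPart_nonneg (v i)).1 (hs'.trans h.symm)
    rw [← hpm, sum_eq_zero fun i hi => by rw [hp i hi, zero_mul],
      sum_eq_zero fun i hi => by rw [hn i hi, zero_mul]] at hvpos
    simp at hvpos
  have hscale : ∀ (u : Fin m → ℝ) k, ∑ i, u i / s * t i ^ k = (∑ i, u i * t i ^ k) / s :=
    fun u k => by
      rw [sum_div]
      exact sum_congr rfl fun i _ => by ring
  refine ⟨fun i => (v i)⁺ / s, fun i => (v i)⁻ / s, fun i => div_nonneg (posPart_nonneg _) hspos.le,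
    fun i => div_nonneg (negPart_nonneg _) hspos.le, fun i hi => ?_, fun i hi => ?_, ?_, ?_,
    fun k hk => ?_, ?_, ?_⟩
  · have : v i ≤ 0 := not_lt.1 fun h => by
      have := hpos i h
      simp only [Pi.sub_apply] at this
      linarith [hb0 i]
    simp [posPart_eq_zero.2 this]
  · have : 0 ≤ v i := not_lt.1 fun h => by
      have := hneg i h
      simp only [Pi.sub_apply] at this
      linarith [ha0 i]
    simp [negPart_eq_zero.2 this]
  · rw [← sum_div, div_self hspos.ne']
  · rw [← sum_div, hs', div_self hspos.ne']
  · rw [hscale, hscale, sub_eq_zero.1 ((hpm k).trans (hv0 k hk))]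
  · rw [hscale, hscale]
    have h := hpm (δ + 1)
    exact div_lt_div_of_pos_right (by linarith) hspos
  · refine (card_le_card fun i hi => ?_).trans (hnegcard.trans (by omega))
    simp only [mem_filter, mem_univ, true_and] at hi ⊢
    by_contra! h
    exact hi (by simp [negPart_eq_zero.2 h])

theorem sum_smul_momentCurve_eq_iff {m δ : ℕ} {t a b : Fin m → ℝ} (ha1 : ∑ i, a i = 1)
    (hb1 : ∑ i, b i = 1) :
    ∑ i, a i • momentCurve δ (t i) = ∑ i, b i • momentCurve δ (t i) ↔
      ∀ k < δ + 1, ∑ i, a i * t i ^ k = ∑ i, b i * t i ^ k := by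
  constructor
  · intro h k hk
    rcases k with _ | k
    · simp [ha1, hb1]
    · simpa [momentCurve] using congrFun h ⟨k, by omega⟩
  · intro h
    ext j
    simpa [momentCurve] using h (j + 1) (by omega)

theorem Triangulation.secondLE_of_supermersionSet_subset {m δ : ℕ} {t : Fin m → ℝ}
    (ht : StrictMono t) {T T' : Triangulation t δ}
    (h : T'.supermersionSet (δ / 2) ⊆ T.supermersionSet (δ / 2)) : T.SecondLE T' := by
  intro x hx
  by_contra! hlt
  have hA := hx
  have hB := hx
  rw [← T.cover, Set.mem_iUnion₂] at hA
  rw [← T'.cover, Set.mem_iUnion₂] at hB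
  obtain ⟨A, hAT, hxA⟩ := hA
  obtain ⟨B, hBT, hxB⟩ := hB
  obtain ⟨a, ha0, haA, ha1, rfl⟩ := exists_weights_of_mem_simplex hxA
  obtain ⟨b, hb0, hbB, hb1, hba⟩ := exists_weights_of_mem_simplex hxB
  rw [T.sec_sum_smul ht hAT ha0 haA ha1, ← hba, T'.sec_sum_smul ht hBT hb0 hbB hb1,
    sum_smul_momentCurve_last, sum_smul_momentCurve_last] at hlt
  obtain ⟨a', b', ha0', hb0', haa', hbb', ha1', hb1', hab', hlt', hcard⟩ :=
    exists_circuit ht ha0 hb0 ((sum_smul_momentCurve_eq_iff ha1 hb1).1 hba.symm) hlt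
  -- The lower part of the circuit may have fewer than `δ / 2 + 1` vertices; it is padded inside `B`
  -- to the exact size that `supermersionSet` demands.
  obtain ⟨F, hF, hFB, hFcard⟩ := exists_subsuperset_card_eq (s := {i | b' i ≠ 0}) (t := B)
    (fun i hi => by
      by_contra hiB
      exact (mem_filter.1 hi).2 (hbb' i (hbB i hiB)))
    hcard (by rw [T'.card_eq B hBT]; omega)
  have hbF : ∀ i ∉ F, b' i = 0 := fun i hi => by
    by_contra hne
    exact hi (hF (by simpa using hne))
  -- At the common point of the circuit, the section of `T` is computed in `A` and lies strictly
  -- above `F`.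
  have hsup := (h ⟨hFcard, T'.supermerges_of_subset ht hBT hFB⟩).2 _
    (sum_smul_mem_simplex t δ hb0' hbF hb1')
  rw [simplexSection_sum_smul ht (by omega) hb0' hbF hb1',
    ← (sum_smul_momentCurve_eq_iff ha1' hb1').2 hab',
    T.sec_sum_smul ht hAT ha0' (fun i hi => haa' i (haA i hi)) ha1',
    sum_smul_momentCurve_last, sum_smul_momentCurve_last] at hsup
  exact absurd hlt' (not_lt.2 hsup)

end CyclicPolytope

theorem theorem5p7 {m δ : ℕ} (hδ : 1 ≤ δ) {t : Fin m → ℝ} (ht : StrictMono t)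
    (T T' : CyclicPolytope.Triangulation t δ) :
    T.SecondLE T' ↔ T'.supermersionSet (δ / 2) ⊆ T.supermersionSet (δ / 2) :=
  ⟨fun h => h.supermersionSet_subset _,
    fun h => CyclicPolytope.Triangulation.secondLE_of_supermersionSet_subset ht h⟩
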